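/- Let $n\ge 1$ and let $H=H(q,y):\mathbb R^n\times\mathbb R^n\to\mathbb R$ satisfy: (i) $q\mapsto H(q,y)$ is convex for every $y$; (ii) $\lim_{|q|\to\infty}\inf_{y\in\mathbb R^n}H(q,y)=+\infty$; (iii) for every $R>0$, $H$ is uniformly continuous and bounded on $B_R\times\mathbb R^n$, where $B_R=\{q:|q|<R\}$. For $p\in\mathbb R^n$ let $\overline H(p)$ be the infimum of all $\mu\in\mathbb R$ for which there is a (globally) Lipschitz function $w:\mathbb R^n\to\mathbb R$ that is a viscosity subsolution of $H(p+Dw,y)\le\mu$ in $\mathbb R^n$ and satisfies $\lim_{|y|\to\infty}|y|^{-1}w(y)=0$. Then for all $p\in\mathbb R^n$, $\mu>\overline H(p)$ and $x_0\in\mathbb R^n$ there is exactly one continuous function $d:\mathbb R^n\to\mathbb R$ that is a viscosity solution of $$H(p+Dd,y)=\mu\quad\text{in }\mathbb R^n\setminus\{x_0\}$$ and satisfies $$\liminf_{|y|\to\infty}|y|^{-1}d(y)>0\quad\text{and}\quad d(x_0)=0.$$ -/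

import Mathlib

open Filter Topology Set

/-- `u` is a viscosity subsolution of `F(Du, y) ≤ μ` in `U`: it is upper semicontinuous on `U`, and
`F(Dφ(x), x) ≤ μ` whenever `x ∈ U`, `φ` is `C¹` near `x`, and `u - φ` has a local maximum at `x`.
It is used for open `U` only. -/
def IsViscositySubsolution {n : ℕ}
    (F : EuclideanSpace ℝ (Fin n) → EuclideanSpace ℝ (Fin n) → ℝ) (μ : ℝ)
    (U : Set (EuclideanSpace ℝ (Fin n))) (u : EuclideanSpace ℝ (Fin n) → ℝ) : Prop :=
  UpperSemicontinuousOn u U ∧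
    ∀ x ∈ U, ∀ φ : EuclideanSpace ℝ (Fin n) → ℝ, ContDiffAt ℝ 1 φ x →
      IsLocalMax (fun y => u y - φ y) x → F (gradient φ x) x ≤ μ

/-- `u` is a viscosity supersolution of `F(Du, y) ≥ μ` in `U`: it is lower semicontinuous on `U`,
and `F(Dφ(x), x) ≥ μ` whenever `x ∈ U`, `φ` is `C¹` near `x`, and `u - φ` has a local minimum
at `x`. It is used for open `U` only. -/
def IsViscositySupersolution {n : ℕ}
    (F : EuclideanSpace ℝ (Fin n) → EuclideanSpace ℝ (Fin n) → ℝ) (μ : ℝ)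
    (U : Set (EuclideanSpace ℝ (Fin n))) (u : EuclideanSpace ℝ (Fin n) → ℝ) : Prop :=
  LowerSemicontinuousOn u U ∧
    ∀ x ∈ U, ∀ φ : EuclideanSpace ℝ (Fin n) → ℝ, ContDiffAt ℝ 1 φ x →
      IsLocalMin (fun y => u y - φ y) x → μ ≤ F (gradient φ x) x

/-- `u` is a viscosity solution of `F(Du, y) = μ` in `U`. -/
def IsViscositySolution {n : ℕ}
    (F : EuclideanSpace ℝ (Fin n) → EuclideanSpace ℝ (Fin n) → ℝ) (μ : ℝ)
    (U : Set (EuclideanSpace ℝ (Fin n))) (u : EuclideanSpace ℝ (Fin n) → ℝ) : Prop :=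
  IsViscositySubsolution F μ U u ∧ IsViscositySupersolution F μ U u

/-- The effective Hamiltonian: the infimum of the `μ` for which `H(p + Dw, y) ≤ μ` has a global
Lipschitz viscosity subsolution `w` with `w(y) / |y| → 0` as `|y| → ∞`. For `H` coercive and
bounded on `B_R × ℝⁿ` for each `R`, this set of `μ` is nonempty and bounded below. -/
noncomputable def effectiveHamiltonian {n : ℕ}
    (H : EuclideanSpace ℝ (Fin n) → EuclideanSpace ℝ (Fin n) → ℝ)
    (p : EuclideanSpace ℝ (Fin n)) : ℝ :=
  sInf {μ : ℝ | ∃ w : EuclideanSpace ℝ (Fin n) → ℝ,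
    (∃ K : NNReal, LipschitzWith K w) ∧
    IsViscositySubsolution (fun q y => H (p + q) y) μ univ w ∧
    Tendsto (fun y => ‖y‖⁻¹ * w y) (cocompact (EuclideanSpace ℝ (Fin n))) (𝓝 0)}

/-
Convexity makes a sublinear subsolution at a level below `μ` stable under small tilts, so adding a
small multiple of `|y - x₀|` gives a subsolution of linear growth. Perron's method in
`ℝⁿ \ {x₀}`, among subsolutions with a prescribed value at `x₀`, then produces `d`; coercivity makes
all these subsolutions uniformly Lipschitz.

For uniqueness, a solution `u` is contracted towards the strict subsolution `w`: by convexity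
`θ u + (1 - θ) w` is a strict subsolution for `θ < 1`, so it can be compared with another solution
`v` as long as `v - θ u` grows at infinity, and a continuation argument in `θ` reaches `θ = 1`.

Comparison and convex combination both rest on a sum rule for limiting superdifferentials,
proved by doubling the variables; coercivity supplies the compactness it needs.
-/

section Gradient

variable {E : Type*} [NormedAddCommGroup E] [InnerProductSpace ℝ E]

theorem contDiffAt_norm_sub_sq (a x : E) : ContDiffAt ℝ 1 (fun y => ‖y - a‖ ^ 2) x :=
  (contDiffAt_id.sub contDiffAt_const).norm_sq ℝ

variable [CompleteSpace E] {f g : E → ℝ} {p q x : E}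

theorem hasGradientAt_add (hf : HasGradientAt f p x) (hg : HasGradientAt g q x) :
    HasGradientAt (fun y => f y + g y) (p + q) x := by
  rw [hasGradientAt_iff_hasFDerivAt] at *
  rw [map_add]
  exact hf.add hg

theorem hasGradientAt_comp {φ : ℝ → ℝ} {φ' : ℝ} (hf : HasGradientAt f p x)
    (hφ : HasDerivAt φ φ' (f x)) : HasGradientAt (fun y => φ (f y)) (φ' • p) x := by
  rw [hasGradientAt_iff_hasFDerivAt] at *
  rw [map_smul]
  exact hφ.comp_hasFDerivAt x hf

theorem hasGradientAt_const_mul (c : ℝ) (hf : HasGradientAt f p x) :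
    HasGradientAt (fun y => c * f y) (c • p) x :=
  hasGradientAt_comp hf (hasDerivAt_const_mul c)

theorem hasGradientAt_neg (hf : HasGradientAt f p x) : HasGradientAt (fun y => -f y) (-p) x := by
  simpa using hasGradientAt_const_mul (-1) hf

theorem hasGradientAt_sub (hf : HasGradientAt f p x) (hg : HasGradientAt g q x) :
    HasGradientAt (fun y => f y - g y) (p - q) x := by
  simpa only [sub_eq_add_neg] using hasGradientAt_add hf (hasGradientAt_neg hg)

theorem hasGradientAt_norm_sub_sq (a x : E) :
    HasGradientAt (fun y => ‖y - a‖ ^ 2) ((2 : ℝ) • (x - a)) x := by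
  rw [hasGradientAt_iff_hasFDerivAt]
  refine ((hasFDerivAt_id x).sub_const a).norm_sq.congr_fderiv ?_
  ext v
  simp [two_smul]

theorem hasGradientAt_norm_sub {a : E} (h : x ≠ a) :
    HasGradientAt (fun y => ‖y - a‖) (‖x - a‖⁻¹ • (x - a)) x := by
  have hne : ‖x - a‖ ≠ 0 := norm_ne_zero_iff.2 (sub_ne_zero.2 h)
  have hsqrt := hasGradientAt_comp (hasGradientAt_norm_sub_sq a x)
    (Real.hasDerivAt_sqrt (pow_ne_zero 2 hne))
  simp only [Real.sqrt_sq (norm_nonneg _), smul_smul] at hsqrt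
  convert hsqrt using 2
  field_simp

theorem continuousAt_gradient (hf : ContDiffAt ℝ 1 f x) : ContinuousAt (gradient f) x :=
  (InnerProductSpace.toDual ℝ E).symm.continuous.continuousAt.comp
    (hf.fderiv_right (m := 0) le_rfl).continuousAt

theorem hasGradientAt_gradient (hf : ContDiffAt ℝ 1 f x) : HasGradientAt f (gradient f x) x :=
  (hf.differentiableAt one_ne_zero).hasGradientAt

theorem eq_zero_of_isLocalMax_of_hasGradientAt (hmax : IsLocalMax f x)
    (hf : HasGradientAt f p x) : p = 0 :=
  (map_eq_zero_iff _ (InnerProductSpace.toDual ℝ E).injective).1 (hmax.hasFDerivAt_eq_zero hf)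

end Gradient

section Superdifferential

variable {E : Type*} [NormedAddCommGroup E] [InnerProductSpace ℝ E] [CompleteSpace E]
  {u v ψ : E → ℝ} {p q x : E}

/-- `p` belongs to the superdifferential `D⁺u(x)`: some `C¹` function with gradient `p` at `x`
touches `u` from above at `x`, up to an additive constant. Subgradients of `v` are the negatives
of the supergradients of `-v`. -/
def IsSupergradientAt (u : E → ℝ) (p x : E) : Prop :=
  ∃ φ : E → ℝ, ContDiffAt ℝ 1 φ x ∧ HasGradientAt φ p x ∧ IsLocalMax (fun y => u y - φ y) x

/-- The graph of the superdifferential of `u`, as a set of pairs (gradient, point). Its closure is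
the graph of the limiting superdifferential. -/
def superdifferentialGraph (u : E → ℝ) : Set (E × E) :=
  {z | IsSupergradientAt u z.1 z.2}

namespace IsSupergradientAt

theorem add_contDiffAt (hu : IsSupergradientAt u p x) (hψ : ContDiffAt ℝ 1 ψ x)
    (hq : HasGradientAt ψ q x) : IsSupergradientAt (fun y => u y + ψ y) (p + q) x := by
  obtain ⟨φ, hφ, hp, hmax⟩ := hu
  exact ⟨fun y => φ y + ψ y, hφ.add hψ, hasGradientAt_add hp hq, by simpa using hmax⟩

theorem const_mul (hu : IsSupergradientAt u p x) {c : ℝ} (hc : 0 ≤ c) :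
    IsSupergradientAt (fun y => c * u y) (c • p) x := by
  obtain ⟨φ, hφ, hp, hmax⟩ := hu
  refine ⟨fun y => c * φ y, contDiffAt_const.mul hφ, hasGradientAt_const_mul c hp, ?_⟩
  filter_upwards [hmax] with y hy
  simpa only [← mul_sub] using mul_le_mul_of_nonneg_left hy hc

theorem of_eventuallyLE (hu : IsSupergradientAt u p x) (hle : v ≤ᶠ[𝓝 x] u) (heq : v x = u x) :
    IsSupergradientAt v p x := by
  obtain ⟨φ, hφ, hp, hmax⟩ := hu
  refine ⟨φ, hφ, hp, ?_⟩
  filter_upwards [hmax, hle] with y hy hvu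
  linarith

theorem eq_of_hasGradientAt (hu : IsSupergradientAt u p x) (hq : HasGradientAt u q x) :
    p = q := by
  obtain ⟨φ, -, hp, hmax⟩ := hu
  exact (sub_eq_zero.1
    (eq_zero_of_isLocalMax_of_hasGradientAt hmax (hasGradientAt_sub hq hp))).symm

theorem norm_le_of_lipschitzWith {K : NNReal} (hp : IsSupergradientAt u p x)
    (hu : LipschitzWith K u) : ‖p‖ ≤ K := by
  obtain ⟨φ, -, hp, hmax⟩ := hp
  have hray : HasDerivAt (fun t : ℝ => x + t • -p) (-p) 0 := by
    simpa using ((hasDerivAt_id (0 : ℝ)).smul_const (-p)).const_add x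
  have hderiv : HasDerivAt (φ ∘ fun t : ℝ => x + t • -p) (-‖p‖ ^ 2) 0 := by
    have hφ : HasFDerivAt φ (InnerProductSpace.toDual ℝ E p) (x + (0 : ℝ) • -p) := by
      simpa using hp.hasFDerivAt
    simpa using hφ.comp_hasDerivAt 0 hray
  have htouch : ∀ᶠ t in 𝓝[>] (0 : ℝ), u (x + t • -p) - φ (x + t • -p) ≤ u x - φ x :=
    Tendsto.eventually (((by fun_prop : Continuous fun t : ℝ => x + t • -p).tendsto' 0 x
      (by simp)).mono_left nhdsWithin_le_nhds) hmax
  have hlower : -(K * ‖p‖) ≤ -‖p‖ ^ 2 := by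
    refine ge_of_tendsto hderiv.tendsto_slope_zero_right ?_
    filter_upwards [htouch, self_mem_nhdsWithin] with t ht ht₀
    have hlip := hu.dist_le_mul x (x + t • -p)
    rw [dist_self_add_right, norm_smul, norm_neg, Real.norm_of_nonneg (le_of_lt ht₀)] at hlip
    have hφ : -(K * ‖p‖) * t ≤ φ (x + t • -p) - φ x := by
      linarith [(le_abs_self _).trans hlip]
    simpa [← div_eq_inv_mul] using (le_div_iff₀ ht₀).2 hφ
  nlinarith [norm_nonneg p, K.2]

end IsSupergradientAt

theorem norm_le_of_mem_closure_superdifferentialGraph {K : NNReal} (hu : LipschitzWith K u)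
    (hp : (p, x) ∈ closure (superdifferentialGraph u)) : ‖p‖ ≤ K := by
  have hclosed : IsClosed {z : E × E | ‖z.1‖ ≤ K} := isClosed_le (by fun_prop) continuous_const
  refine closure_minimal ?_ hclosed hp
  rintro ⟨q, y⟩ hq
  exact IsSupergradientAt.norm_le_of_lipschitzWith hq hu

end Superdifferential

section SumRule

variable {E : Type*} [NormedAddCommGroup E]

theorem exists_forall_norm_sub_lt_of_penalty_le {B : Set E} {v : E → ℝ} (hB : IsCompact B)
    (hv : ContinuousOn v B) {ε : ℝ} (hε : 0 < ε) :
    ∃ k : ℝ, ∀ x, ∀ y ∈ B, ∀ z ∈ B, k * ‖y - z‖ ^ 2 + ‖y - x‖ ^ 2 ≤ v z - v y →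
      ‖y - z‖ < ε ∧ ‖y - x‖ < ε := by
  obtain ⟨δ, hδ, hvδ⟩ := Metric.uniformContinuousOn_iff.1
    (hB.uniformContinuousOn_of_continuous hv) (ε ^ 2) (by positivity)
  obtain ⟨C, hC⟩ := hB.exists_bound_of_continuousOn hv
  set η := min δ ε
  have hη : 0 < η := by positivity
  obtain ⟨k, hk, hkη⟩ : ∃ k : ℝ, 0 < k ∧ 2 * C < k * η ^ 2 := by
    refine ⟨(2 * |C| + 1) / η ^ 2, by positivity, ?_⟩
    rw [div_mul_cancel₀ _ (by positivity)]
    linarith [le_abs_self C]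
  refine ⟨k, fun x y hy z hz hpenalty => ?_⟩
  have hyz : ‖y - z‖ < η := by
    refine lt_of_pow_lt_pow_left₀ 2 hη.le (lt_of_mul_lt_mul_left ?_ hk.le)
    have hvz := hC z hz
    have hvy := hC y hy
    rw [Real.norm_eq_abs] at hvz hvy
    linarith [le_abs_self (v z), neg_abs_le (v y), sq_nonneg ‖y - x‖]
  refine ⟨hyz.trans_le (min_le_right _ _), lt_of_pow_lt_pow_left₀ 2 hε.le ?_⟩
  have hosc : |v z - v y| < ε ^ 2 := by
    have hdist : dist z y < δ := by
      rw [dist_comm, dist_eq_norm]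
      exact hyz.trans_le (min_le_left _ _)
    exact hvδ z hz y hy hdist
  linarith [le_abs_self (v z - v y), mul_nonneg hk.le (sq_nonneg ‖y - z‖)]

theorem exists_max_doubled_variables [ProperSpace E] {u v : E → ℝ} {x : E} {r : ℝ} (hr : 0 ≤ r)
    (hu : ContinuousOn u (Metric.closedBall x r)) (hv : ContinuousOn v (Metric.closedBall x r))
    (hmax : IsMaxOn (fun y => u y + v y) (Metric.closedBall x r) x) {ε : ℝ} (hε : 0 < ε) :
    ∃ k : ℝ, ∃ y ∈ Metric.ball x ε, ∃ z ∈ Metric.ball x ε,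
      ∀ y' ∈ Metric.closedBall x r, ∀ z' ∈ Metric.closedBall x r,
        u y' + v z' - (k * ‖y' - z'‖ ^ 2 + ‖y' - x‖ ^ 2) ≤
          u y + v z - (k * ‖y - z‖ ^ 2 + ‖y - x‖ ^ 2) := by
  set B := Metric.closedBall x r
  have hB : IsCompact B := isCompact_closedBall x r
  have hxB : x ∈ B := Metric.mem_closedBall_self hr
  obtain ⟨k, hk⟩ := exists_forall_norm_sub_lt_of_penalty_le hB hv (half_pos hε)
  obtain ⟨⟨y, z⟩, ⟨hy, hz⟩, hyz⟩ := (hB.prod hB).exists_isMaxOn ⟨(x, x), hxB, hxB⟩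
    (f := fun w : E × E => u w.1 + v w.2 - (k * ‖w.1 - w.2‖ ^ 2 + ‖w.1 - x‖ ^ 2))
    (((hu.comp continuousOn_fst fun _ h => h.1).add (hv.comp continuousOn_snd fun _ h => h.2)).sub
      (by fun_prop))
  have hpenalty : k * ‖y - z‖ ^ 2 + ‖y - x‖ ^ 2 ≤ v z - v y := by
    have hdiag := hyz (Set.mk_mem_prod hxB hxB)
    have hmaxy := hmax hy
    simp only [mem_ofPred_eq, sub_self, norm_zero] at hdiag hmaxy
    linarith
  obtain ⟨hyz_lt, hyx⟩ := hk x y hy z hz hpenalty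
  have hzx : ‖z - x‖ < ε := by
    have htriangle := norm_sub_le_norm_sub_add_norm_sub z y x
    rw [norm_sub_rev z y] at htriangle
    linarith
  refine ⟨k, y, ?_, z, by simpa [dist_eq_norm] using hzx,
    fun y' hy' z' hz' => hyz (a := (y', z')) ⟨hy', hz'⟩⟩
  simpa [dist_eq_norm] using hyx.trans (half_lt_self hε)

variable [InnerProductSpace ℝ E] [ProperSpace E] {u v : E → ℝ} {p x : E}

theorem exists_isSupergradientAt_of_isLocalMax_add (hu : ∀ᶠ y in 𝓝 x, ContinuousAt u y)
    (hv : ∀ᶠ y in 𝓝 x, ContinuousAt v y) (hmax : IsLocalMax (fun y => u y + v y) x) {ε : ℝ}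
    (hε : 0 < ε) :
    ∃ y ∈ Metric.ball x ε, ∃ z ∈ Metric.ball x ε, ∃ p q,
      IsSupergradientAt u p y ∧ IsSupergradientAt v q z ∧ ‖p + q‖ < ε := by
  obtain ⟨r, hr, hball⟩ := Metric.nhds_basis_closedBall.mem_iff.1 ((hu.and hv).and hmax)
  obtain ⟨k, y, hy, z, hz, hyz⟩ := exists_max_doubled_variables hr.le
    (fun y hy => (hball hy).1.1.continuousWithinAt)
    (fun y hy => (hball hy).1.2.continuousWithinAt) (fun y hy => (hball hy).2)
    (lt_min hr (half_pos hε))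
  rw [Metric.mem_ball, dist_eq_norm, lt_min_iff] at hy hz
  have hyB : Metric.closedBall x r ∈ 𝓝 y :=
    Metric.closedBall_mem_nhds_of_mem (by simpa [dist_eq_norm] using hy.1)
  have hzB : Metric.closedBall x r ∈ 𝓝 z :=
    Metric.closedBall_mem_nhds_of_mem (by simpa [dist_eq_norm] using hz.1)
  refine ⟨y, ?_, z, ?_, k • (2 : ℝ) • (y - z) + (2 : ℝ) • (y - x), k • (2 : ℝ) • (z - y),
    ⟨fun w => k * ‖w - z‖ ^ 2 + ‖w - x‖ ^ 2,
      (contDiffAt_const.mul (contDiffAt_norm_sub_sq z y)).add (contDiffAt_norm_sub_sq x y), ?_, ?_⟩,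
    ⟨fun w => k * ‖w - y‖ ^ 2, contDiffAt_const.mul (contDiffAt_norm_sub_sq y z), ?_, ?_⟩, ?_⟩
  · simpa [dist_eq_norm] using hy.2.trans (half_lt_self hε)
  · simpa [dist_eq_norm] using hz.2.trans (half_lt_self hε)
  · exact hasGradientAt_add (hasGradientAt_const_mul k (hasGradientAt_norm_sub_sq z y))
      (hasGradientAt_norm_sub_sq x y)
  · filter_upwards [hyB] with w hw
    linarith [hyz w hw z (mem_of_mem_nhds hzB)]
  · exact hasGradientAt_const_mul k (hasGradientAt_norm_sub_sq y z)
  · filter_upwards [hzB] with w hw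
    have := hyz y (mem_of_mem_nhds hyB) w hw
    simp only [norm_sub_rev y] at this
    linarith
  · have hsum : k • (2 : ℝ) • (y - z) + (2 : ℝ) • (y - x) + k • (2 : ℝ) • (z - y) =
        (2 : ℝ) • (y - x) := by module
    rw [hsum, norm_smul, Real.norm_two]
    linarith [hy.2]

theorem IsSupergradientAt.exists_mem_closure_of_add
    (hp : IsSupergradientAt (fun y => u y + v y) p x) (hu : ∀ᶠ y in 𝓝 x, ContinuousAt u y)
    (hv : ∀ᶠ y in 𝓝 x, ContinuousAt v y) {L : ℝ}
    (hL : ∀ᶠ y in 𝓝 x, ∀ q, IsSupergradientAt u q y → ‖q‖ ≤ L) :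
    ∃ q, (q, x) ∈ closure (superdifferentialGraph u) ∧
      (p - q, x) ∈ closure (superdifferentialGraph v) := by
  obtain ⟨φ, hφ, hφp, hmax⟩ := hp
  have hφ_near : ∀ᶠ y in 𝓝 x, ContDiffAt ℝ 1 φ y := hφ.eventually (by simp)
  have happrox : ∀ k : ℕ, ∃ y ∈ Metric.ball x (1 / (k + 1)), ∃ z ∈ Metric.ball x (1 / (k + 1)),
      ∃ p q, IsSupergradientAt u p y ∧ IsSupergradientAt (fun y => v y - φ y) q z ∧
        ‖p + q‖ < 1 / (k + 1) := fun k =>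
    exists_isSupergradientAt_of_isLocalMax_add hu
      (hv.mp (hφ_near.mono fun y hφy hvy => hvy.sub hφy.continuousAt))
      (by simpa [add_sub_assoc] using hmax) Nat.one_div_pos_of_nat
  choose y hy z hz q q' hq hq' hqq' using happrox
  have hzero := tendsto_one_div_add_atTop_nhds_zero_nat (𝕜 := ℝ)
  have hyx : Tendsto y atTop (𝓝 x) :=
    tendsto_iff_dist_tendsto_zero.2 (squeeze_zero (fun _ => dist_nonneg) (fun k => (hy k).le) hzero)
  have hzx : Tendsto z atTop (𝓝 x) :=
    tendsto_iff_dist_tendsto_zero.2 (squeeze_zero (fun _ => dist_nonneg) (fun k => (hz k).le) hzero)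
  have hsum : Tendsto (fun k => q k + q' k) atTop (𝓝 0) :=
    squeeze_zero_norm (fun k => (hqq' k).le) hzero
  obtain ⟨q₀, -, σ, hσ, hqσ⟩ := tendsto_subseq_of_frequently_bounded
    (Metric.isBounded_closedBall (x := (0 : E)) (r := L))
    ((hyx.eventually hL).mono fun k hk => by simpa using hk (q k) (hq k)).frequently
  have hzσ := hzx.comp hσ.tendsto_atTop
  have hlim : Tendsto (fun k => q' (σ k) + gradient φ (z (σ k))) atTop (𝓝 (p - q₀)) := by
    have hgrad : Tendsto (fun k => gradient φ (z (σ k))) atTop (𝓝 p) :=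
      hφp.gradient ▸ (continuousAt_gradient hφ).tendsto.comp hzσ
    convert ((hsum.comp hσ.tendsto_atTop).sub hqσ).add hgrad using 2 <;> simp; abel
  refine ⟨q₀, mem_closure_of_tendsto (hqσ.prodMk_nhds (hyx.comp hσ.tendsto_atTop))
    (Eventually.of_forall fun k => hq (σ k)), mem_closure_of_tendsto (hlim.prodMk_nhds hzσ) ?_⟩
  filter_upwards [hzσ.eventually hφ_near] with k hk
  simpa [superdifferentialGraph] using (hq' (σ k)).add_contDiffAt hk (hasGradientAt_gradient hk)

theorem IsSupergradientAt.mem_closure_of_isLUB {S : Set (E → ℝ)} (hS : ∀ v ∈ S, Continuous v)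
    (hsup : ∀ y, IsLUB ((fun v => v y) '' S) (u y)) (hp : IsSupergradientAt u p x) :
    (p, x) ∈ closure (⋃ v ∈ S, superdifferentialGraph v) := by
  obtain ⟨φ, hφ, hφp, hmax⟩ := hp
  have hlim : Tendsto (fun y => (gradient φ y + (2 : ℝ) • (y - x), y)) (𝓝 x) (𝓝 (p, x)) := by
    have hgrad := continuousAt_gradient hφ
    have : ContinuousAt (fun y => (gradient φ y + (2 : ℝ) • (y - x), y)) x := by fun_prop
    simpa [hφp.gradient, ContinuousAt] using this
  refine mem_closure_iff_nhds.2 fun O hO => ?_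
  obtain ⟨r, hr, hball⟩ := Metric.nhds_basis_closedBall.mem_iff.1
    (((hφ.eventually (by simp)).and hmax).and (hlim hO))
  obtain ⟨_, ⟨v, hvS, rfl⟩, hvx⟩ := (lt_isLUB_iff (hsup x)).1 (sub_lt_self (u x) (pow_pos hr 2))
  obtain ⟨y, hyB, hy⟩ := (isCompact_closedBall x r).exists_isMaxOn
    ⟨x, Metric.mem_closedBall_self hr.le⟩
    (f := fun y => v y - (φ y + ‖y - x‖ ^ 2)) ((hS v hvS).continuousOn.sub
      (ContinuousOn.add (fun y hy => (hball hy).1.1.continuousAt.continuousWithinAt)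
        (by fun_prop)))
  obtain ⟨⟨hφy, huy⟩, hyO⟩ := hball hyB
  have hyx : ‖y - x‖ < r := by
    have hxy := hy (Metric.mem_closedBall_self hr.le)
    have hvy : v y ≤ u y := (hsup y).1 ⟨v, hvS, rfl⟩
    simp only [mem_ofPred_eq, sub_self, norm_zero] at hxy huy hvx
    exact lt_of_pow_lt_pow_left₀ 2 hr.le (by linarith)
  refine ⟨_, hyO, Set.mem_biUnion hvS ⟨fun y => φ y + ‖y - x‖ ^ 2,
    hφy.add (contDiffAt_norm_sub_sq x y),
    hasGradientAt_add (hasGradientAt_gradient hφy) (hasGradientAt_norm_sub_sq x y),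
    hy.isLocalMax (Metric.closedBall_mem_nhds_of_mem (by simpa [dist_eq_norm] using hyx))⟩⟩

end SumRule

section LipschitzBound

variable {E : Type*} [NormedAddCommGroup E] [InnerProductSpace ℝ E] [ProperSpace E] {u : E → ℝ}
  {a : E} {r : ℝ}

theorem sub_le_radial_of_isSupergradientAt_norm_le {L : ℝ} {ψ : ℝ → ℝ} (hr : 0 ≤ r)
    (hu : ContinuousOn u (Metric.closedBall a r))
    (hL : ∀ x ∈ Metric.ball a r, x ≠ a → ∀ p, IsSupergradientAt u p x → ‖p‖ ≤ L)
    (hψ : ContDiff ℝ 1 ψ) (hψ' : ∀ s, 0 < s → L < deriv ψ s)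
    (hsphere : ∀ y ∈ Metric.sphere a r, u y - u a ≤ ψ r - ψ 0) {y : E}
    (hy : y ∈ Metric.closedBall a r) : u y - u a ≤ ψ ‖y - a‖ - ψ 0 := by
  obtain ⟨x, hxr, hx⟩ := (isCompact_closedBall a r).exists_isMaxOn
    ⟨a, Metric.mem_closedBall_self hr⟩ (f := fun y => u y - ψ ‖y - a‖)
    (hu.sub (hψ.continuous.comp (by fun_prop)).continuousOn)
  suffices u x - ψ ‖x - a‖ ≤ u a - ψ 0 by
    have hyx : u y - ψ ‖y - a‖ ≤ u x - ψ ‖x - a‖ := hx hy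
    linarith
  by_cases hxa : x = a
  · simp [hxa]
  rcases (Metric.mem_closedBall.1 hxr).eq_or_lt with hxs | hxb
  · have := hsphere x hxs
    rw [← dist_eq_norm, hxs]
    linarith
  have hpos : 0 < ‖x - a‖ := norm_pos_iff.2 (sub_ne_zero.2 hxa)
  have hp : IsSupergradientAt u (deriv ψ ‖x - a‖ • ‖x - a‖⁻¹ • (x - a)) x :=
    ⟨fun y => ψ ‖y - a‖,
      hψ.contDiffAt.comp x ((contDiffAt_id.sub contDiffAt_const).norm ℝ (sub_ne_zero.2 hxa)),
      hasGradientAt_comp (hasGradientAt_norm_sub hxa)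
        (hψ.differentiable one_ne_zero ‖x - a‖).hasDerivAt,
      hx.isLocalMax (Metric.closedBall_mem_nhds_of_mem hxb)⟩
  have hnorm := hL x hxb hxa _ hp
  rw [norm_smul, norm_smul, norm_inv, norm_norm, inv_mul_cancel₀ hpos.ne', mul_one] at hnorm
  exact absurd (le_abs_self _) (hnorm.trans_lt (hψ' _ hpos)).not_ge

-- The power is `1` on the sphere, where it absorbs the boundary values of `u`, and tends to `0` in
-- the open ball as `m → ∞`.
theorem sub_le_mul_norm_add_mul_pow_of_isSupergradientAt_norm_le {L K M : ℝ} (hr : 0 < r)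
    (hu : ContinuousOn u (Metric.closedBall a r))
    (hL : ∀ x ∈ Metric.ball a r, x ≠ a → ∀ p, IsSupergradientAt u p x → ‖p‖ ≤ L) (hLK : L < K)
    (hM₀ : 0 ≤ M) (hM : ∀ z ∈ Metric.sphere a r, u z - u a ≤ K * r + M) (m : ℕ) {y : E}
    (hy : y ∈ Metric.closedBall a r) :
    u y - u a ≤ K * ‖y - a‖ + M * (‖y - a‖ / r) ^ (m + 1) := by
  set ψ : ℝ → ℝ := fun s => K * s + M * (s / r) ^ (m + 1)
  have hderiv (s : ℝ) : HasDerivAt ψ (K + M * ((m + 1 : ℕ) * (s / r) ^ m * (1 / r))) s := by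
    simpa [ψ] using (hasDerivAt_const_mul K).fun_add
      ((((hasDerivAt_id s).div_const r).fun_pow (m + 1)).const_mul M)
  have hψ' (s : ℝ) (hs : 0 < s) : L < deriv ψ s := by
    rw [(hderiv s).deriv]
    have : 0 ≤ M * ((m + 1 : ℕ) * (s / r) ^ m * (1 / r)) := by positivity
    linarith
  simpa [ψ] using sub_le_radial_of_isSupergradientAt_norm_le hr.le hu hL
    (by fun_prop : ContDiff ℝ 1 ψ) hψ' (by simpa [ψ, hr.ne'] using hM) hy

theorem sub_le_mul_norm_of_isSupergradientAt_norm_le {L : ℝ} (hr : 0 < r)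
    (hu : ContinuousOn u (Metric.closedBall a r))
    (hL : ∀ x ∈ Metric.ball a r, x ≠ a → ∀ p, IsSupergradientAt u p x → ‖p‖ ≤ L) {y : E}
    (hy : y ∈ Metric.closedBall a r) : u y - u a ≤ L * ‖y - a‖ := by
  obtain ⟨C, hC⟩ : ∃ C, ∀ z ∈ Metric.closedBall a r, |u z - u a| ≤ C :=
    (isCompact_closedBall a r).exists_bound_of_continuousOn (hu.sub continuousOn_const)
  set M := |C| + |L| * r
  have hM (m : ℕ) (z : E) (hz : z ∈ Metric.sphere a r) :
      u z - u a ≤ (L + 1 / (m + 1)) * r + M := by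
    have hm : 0 ≤ 1 / ((m : ℝ) + 1) * r := by positivity
    linarith [le_abs_self (u z - u a), hC z (Metric.sphere_subset_closedBall hz), le_abs_self C,
      mul_le_mul_of_nonneg_right (neg_abs_le L) hr.le]
  have hball : ∀ y ∈ Metric.ball a r, u y - u a ≤ L * ‖y - a‖ := by
    intro y hy
    have hy' : ‖y - a‖ / r < 1 := (div_lt_one hr).2 (by simpa [dist_eq_norm] using hy)
    have hpow := (tendsto_pow_atTop_nhds_zero_of_lt_one (by positivity) hy').comp
      (tendsto_add_atTop_nat 1)
    have hlim := (((tendsto_one_div_add_atTop_nhds_zero_nat (𝕜 := ℝ)).const_add L).mul_const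
      ‖y - a‖).add (hpow.const_mul M)
    simpa using ge_of_tendsto' hlim fun m =>
      sub_le_mul_norm_add_mul_pow_of_isSupergradientAt_norm_le hr hu hL
        (lt_add_of_pos_right L Nat.one_div_pos_of_nat) (by positivity) (hM m) m
        (Metric.ball_subset_closedBall hy)
  rw [← closure_ball a hr.ne'] at hu hy
  exact le_on_closure hball (hu.sub continuousOn_const) (by fun_prop) hy

theorem lipschitzWith_of_isSupergradientAt_norm_le {L : NNReal} (hu : Continuous u) (x₀ : E)
    (hL : ∀ x ≠ x₀, ∀ p, IsSupergradientAt u p x → ‖p‖ ≤ L) : LipschitzWith (3 * L) u := by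
  have hcenter (y : E) : u y - u x₀ ≤ L * ‖y - x₀‖ :=
    sub_le_mul_norm_of_isSupergradientAt_norm_le (r := ‖y - x₀‖ + 1) (by positivity)
      hu.continuousOn (fun x _ => hL x) (by simp [dist_eq_norm])
  have hnear (a y : E) (hy : ‖y - a‖ ≤ ‖x₀ - a‖) : u y - u a ≤ L * ‖y - a‖ := by
    rcases (norm_nonneg (x₀ - a)).eq_or_lt with h | h
    · simp [sub_eq_zero.1 (norm_le_zero_iff.1 (hy.trans h.ge))]
    · refine sub_le_mul_norm_of_isSupergradientAt_norm_le h hu.continuousOn (fun x hx _ => hL x ?_)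
        (by simpa [dist_eq_norm] using hy)
      rintro rfl
      simp [dist_eq_norm] at hx
  refine LipschitzWith.of_le_add_mul (3 * L) fun y a => ?_
  rw [dist_eq_norm, NNReal.coe_mul, NNReal.coe_ofNat]
  have hL0 : 0 ≤ (L : ℝ) * ‖y - a‖ := by positivity
  rcases le_or_gt ‖y - a‖ ‖x₀ - a‖ with h | h
  · linarith [hnear a y h]
  · have htriangle := mul_le_mul_of_nonneg_left (norm_sub_le_norm_sub_add_norm_sub y a x₀) L.2
    have hle := mul_le_mul_of_nonneg_left h.le L.2
    rw [norm_sub_rev a x₀] at htriangle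
    simp only [NNReal.val_eq_coe] at htriangle hle
    linarith [hcenter y, hnear a x₀ le_rfl]

end LipschitzBound

section Viscosity

variable {n : ℕ} {F : EuclideanSpace ℝ (Fin n) → EuclideanSpace ℝ (Fin n) → ℝ} {μ μ' : ℝ}
  {U V : Set (EuclideanSpace ℝ (Fin n))} {u v w ψ : EuclideanSpace ℝ (Fin n) → ℝ}
  {p x : EuclideanSpace ℝ (Fin n)}

theorem isViscositySubsolution_iff :
    IsViscositySubsolution F μ U u ↔
      UpperSemicontinuousOn u U ∧ ∀ x ∈ U, ∀ p, IsSupergradientAt u p x → F p x ≤ μ := by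
  refine and_congr_right fun _ => forall₂_congr fun x _ => ⟨?_, fun h φ hφ hmax =>
    h _ ⟨φ, hφ, hasGradientAt_gradient hφ, hmax⟩⟩
  rintro h p ⟨φ, hφ, hp, hmax⟩
  exact hp.gradient ▸ h φ hφ hmax

theorem isViscositySupersolution_iff_neg :
    IsViscositySupersolution F μ U v ↔
      IsViscositySubsolution (fun q y => -F (-q) y) (-μ) U (fun y => -v y) := by
  rw [isViscositySubsolution_iff]
  refine and_congr ⟨fun h => h.neg, fun h => neg_neg v ▸ UpperSemicontinuousOn.neg (f := -v) h⟩
    (forall₂_congr fun x _ => ⟨?_, fun h φ hφ hmin => ?_⟩)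
  · rintro h p ⟨φ, hφ, hp, hmax⟩
    have hmin := h (fun y => -φ y) hφ.neg (by simpa [add_comm] using hmax.neg)
    rw [(hasGradientAt_neg hp).gradient] at hmin
    exact neg_le_neg hmin
  · have := h _ ⟨fun y => -φ y, hφ.neg, hasGradientAt_neg (hasGradientAt_gradient hφ),
      by simpa [neg_add_eq_sub] using hmin.neg⟩
    rwa [neg_neg, neg_le_neg_iff] at this

theorem isViscositySubsolution_of_contDiffAt (hu : ∀ y ∈ U, ContDiffAt ℝ 1 u y)
    (hF : ∀ y ∈ U, F (gradient u y) y ≤ μ) : IsViscositySubsolution F μ U u := by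
  refine isViscositySubsolution_iff.2
    ⟨fun y hy => (hu y hy).continuousAt.upperSemicontinuousAt.upperSemicontinuousWithinAt U,
      fun y hy p hp => ?_⟩
  rw [hp.eq_of_hasGradientAt (hasGradientAt_gradient (hu y hy))]
  exact hF y hy

namespace IsViscositySubsolution

theorem mono (hu : IsViscositySubsolution F μ U u) (hVU : V ⊆ U) (hμ : μ ≤ μ') :
    IsViscositySubsolution F μ' V u :=
  ⟨hu.1.mono hVU, fun x hx φ hφ hmax => (hu.2 x (hVU hx) φ hφ hmax).trans hμ⟩

theorem const_mul {c : ℝ} (hc : 0 < c) (hu : IsViscositySubsolution F μ U u) :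
    IsViscositySubsolution (fun q y => F (c⁻¹ • q) y) μ U (fun y => c * u y) := by
  refine isViscositySubsolution_iff.2 ⟨fun x hx => ?_, fun x hx p hp => ?_⟩
  · exact ((continuous_const_mul c).continuousAt.comp_upperSemicontinuousWithinAt (hu.1 x hx)
      (monotone_mul_left_of_nonneg hc.le))
  · have := hp.const_mul (inv_nonneg.2 hc.le)
    simp only [inv_mul_cancel_left₀ hc.ne'] at this
    exact (isViscositySubsolution_iff.1 hu).2 x hx _ this

theorem le_of_mem_closure_biUnion {S : Set (EuclideanSpace ℝ (Fin n) → ℝ)}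
    (hS : ∀ u ∈ S, IsViscositySubsolution F μ U u) (hF : Continuous (Function.uncurry F))
    (hU : IsOpen U) (hx : x ∈ U) (hp : (p, x) ∈ closure (⋃ u ∈ S, superdifferentialGraph u)) :
    F p x ≤ μ := by
  have hclosed : IsClosed {z | Function.uncurry F z ≤ μ} := isClosed_le hF continuous_const
  refine closure_minimal ?_ hclosed ((isOpen_univ.prod hU).inter_closure ⟨⟨mem_univ _, hx⟩, hp⟩)
  rintro ⟨q, y⟩ ⟨⟨-, hy⟩, hq⟩
  obtain ⟨u, hu, hqu⟩ := mem_iUnion₂.1 hq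
  exact (isViscositySubsolution_iff.1 (hS u hu)).2 y hy q hqu

theorem le_of_mem_closure (hu : IsViscositySubsolution F μ U u)
    (hF : Continuous (Function.uncurry F)) (hU : IsOpen U) (hx : x ∈ U)
    (hp : (p, x) ∈ closure (superdifferentialGraph u)) : F p x ≤ μ :=
  le_of_mem_closure_biUnion (S := {u}) (by simpa using hu) hF hU hx (by simpa using hp)

theorem norm_le_of_isSupergradientAt {L : ℝ} (hu : IsViscositySubsolution F μ U u)
    (hL : ∀ q y, F q y ≤ μ → ‖q‖ ≤ L) (hx : x ∈ U) (hp : IsSupergradientAt u p x) : ‖p‖ ≤ L :=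
  hL p x ((isViscositySubsolution_iff.1 hu).2 x hx p hp)

theorem add_lipschitzWith {L : ℝ} {δ : NNReal} (hF : Continuous (Function.uncurry F))
    (hL : ∀ q y, F q y ≤ μ → ‖q‖ ≤ L) (hδ : ∀ q e y, F q y ≤ μ → ‖e‖ ≤ δ → F (q + e) y ≤ μ')
    (hU : IsOpen U) (hu : IsViscositySubsolution F μ U u) (huU : ContinuousOn u U)
    (hψ : LipschitzWith δ ψ) : IsViscositySubsolution F μ' U (fun y => u y + ψ y) := by
  refine isViscositySubsolution_iff.2
    ⟨(huU.add hψ.continuous.continuousOn).upperSemicontinuousOn, fun x hx p hp => ?_⟩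
  have hUx : ∀ᶠ y in 𝓝 x, y ∈ U := hU.mem_nhds hx
  obtain ⟨q, hqu, hqψ⟩ := hp.exists_mem_closure_of_add
    (hUx.mono fun y hy => huU.continuousAt (hU.mem_nhds hy))
    (Eventually.of_forall fun _ => hψ.continuous.continuousAt)
    (hUx.mono fun y hy q hq => hu.norm_le_of_isSupergradientAt hL hy hq)
  simpa using hδ q (p - q) x (hu.le_of_mem_closure hF hU hx hqu)
    (norm_le_of_mem_closure_superdifferentialGraph hψ hqψ)

theorem convexCombination {L θ : ℝ} (hF : Continuous (Function.uncurry F))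
    (hconvex : ∀ y, ConvexOn ℝ univ fun q => F q y) (hL : ∀ q y, F q y ≤ μ → ‖q‖ ≤ L)
    (hU : IsOpen U) (hu : IsViscositySubsolution F μ U u) (hw : IsViscositySubsolution F μ' U w)
    (huU : ContinuousOn u U) (hwU : ContinuousOn w U) (hθ : θ ∈ Ioo 0 1) :
    IsViscositySubsolution F (θ * μ + (1 - θ) * μ') U (fun y => θ * u y + (1 - θ) * w y) := by
  have hθ' : 0 < 1 - θ := sub_pos.2 hθ.2
  have hscale (c : ℝ) : Continuous (Function.uncurry fun q y => F (c • q) y) :=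
    hF.comp ((continuous_const_smul c).prodMap continuous_id)
  have hθu : ContinuousOn (fun y => θ * u y) U := huU.const_smul θ
  have hθw : ContinuousOn (fun y => (1 - θ) * w y) U := hwU.const_smul (1 - θ)
  refine isViscositySubsolution_iff.2 ⟨(hθu.add hθw).upperSemicontinuousOn, fun x hx p hp => ?_⟩
  have hUx : ∀ᶠ y in 𝓝 x, y ∈ U := hU.mem_nhds hx
  obtain ⟨q, hqu, hqw⟩ := hp.exists_mem_closure_of_add
    (hUx.mono fun y hy => hθu.continuousAt (hU.mem_nhds hy))
    (hUx.mono fun y hy => hθw.continuousAt (hU.mem_nhds hy))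
    (hUx.mono fun y hy q hq => (hu.const_mul hθ.1).norm_le_of_isSupergradientAt (L := θ * L)
      (fun q y hq => by
        have := hL _ y hq
        rwa [norm_smul, norm_inv, Real.norm_of_nonneg hθ.1.le, inv_mul_le_iff₀ hθ.1] at this)
      hy hq)
  calc F p x = F (θ • θ⁻¹ • q + (1 - θ) • (1 - θ)⁻¹ • (p - q)) x := by
        rw [smul_inv_smul₀ hθ.1.ne', smul_inv_smul₀ hθ'.ne', add_sub_cancel]
    _ ≤ θ • F (θ⁻¹ • q) x + (1 - θ) • F ((1 - θ)⁻¹ • (p - q)) x :=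
        (hconvex x).2 (mem_univ _) (mem_univ _) hθ.1.le hθ'.le (add_sub_cancel _ _)
    _ ≤ θ * μ + (1 - θ) * μ' :=
        add_le_add
          (mul_le_mul_of_nonneg_left
            ((hu.const_mul hθ.1).le_of_mem_closure (hscale _) hU hx hqu) hθ.1.le)
          (mul_le_mul_of_nonneg_left
            ((hw.const_mul hθ').le_of_mem_closure (hscale _) hU hx hqw) hθ'.le)

end IsViscositySubsolution

theorem IsViscositySupersolution.not_isLocalMin_sub {L : ℝ} (hF : Continuous (Function.uncurry F))
    (hL : ∀ q y, F q y ≤ μ' → ‖q‖ ≤ L) (hU : IsOpen U) (hv : IsViscositySupersolution F μ U v)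
    (hu : IsViscositySubsolution F μ' U u) (hμ : μ' < μ) (hvU : ContinuousOn v U)
    (huU : ContinuousOn u U) (hx : x ∈ U) : ¬ IsLocalMin (fun y => v y - u y) x := by
  intro hmin
  have hUx : ∀ᶠ y in 𝓝 x, y ∈ U := hU.mem_nhds hx
  have hzero : IsSupergradientAt (fun y => u y + -v y) 0 x :=
    ⟨fun _ => 0, contDiffAt_const, hasGradientAt_const x 0,
      by simpa [sub_eq_add_neg, add_comm] using hmin.neg⟩
  obtain ⟨q, hqu, hqv⟩ := hzero.exists_mem_closure_of_add
    (hUx.mono fun y hy => huU.continuousAt (hU.mem_nhds hy))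
    (hUx.mono fun y hy => (hvU.continuousAt (hU.mem_nhds hy)).neg)
    (hUx.mono fun y hy q hq => hu.norm_le_of_isSupergradientAt hL hy hq)
  have hsuper := (isViscositySupersolution_iff_neg.1 hv).le_of_mem_closure
    (hF.comp (continuous_neg.prodMap continuous_id)).neg hU hx hqv
  have hsub := hu.le_of_mem_closure hF hU hx hqu
  rw [zero_sub, neg_neg, neg_le_neg_iff] at hsuper
  exact (hμ.trans_le (hsuper.trans hsub)).false

theorem IsViscositySupersolution.sub_le_sub_of_tendsto_atTop {L : ℝ}
    {x₀ : EuclideanSpace ℝ (Fin n)} (hF : Continuous (Function.uncurry F))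
    (hL : ∀ q y, F q y ≤ μ' → ‖q‖ ≤ L) (hv : IsViscositySupersolution F μ {x₀}ᶜ v)
    (hu : IsViscositySubsolution F μ' {x₀}ᶜ u) (hμ : μ' < μ) (hvc : Continuous v)
    (huc : Continuous u)
    (hlim : Tendsto (fun y => v y - u y) (cocompact (EuclideanSpace ℝ (Fin n))) atTop)
    (y : EuclideanSpace ℝ (Fin n)) : v x₀ - u x₀ ≤ v y - u y := by
  obtain ⟨z, hz⟩ := (hvc.sub huc).exists_forall_le hlim
  have hzx : z = x₀ := by
    by_contra hne
    exact hv.not_isLocalMin_sub hF hL isOpen_compl_singleton hu hμ hvc.continuousOn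
      huc.continuousOn hne (Eventually.of_forall hz)
  exact hzx ▸ hz y

end Viscosity

section Perron

theorem continuous_piecewise_sup {X : Type*} [TopologicalSpace X] {f g : X → ℝ} {s : Set X}
    [∀ x, Decidable (x ∈ s)] (hf : Continuous f) (hg : ContinuousOn g (closure s))
    (hgf : ∀ x ∈ frontier s, g x ≤ f x) : Continuous (s.piecewise (f ⊔ g) f) :=
  continuous_piecewise (fun x hx => sup_eq_left.2 (hgf x hx)) (hf.continuousOn.sup hg)
    hf.continuousOn

variable {n : ℕ} {F : EuclideanSpace ℝ (Fin n) → EuclideanSpace ℝ (Fin n) → ℝ} {μ : ℝ}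
  {U O : Set (EuclideanSpace ℝ (Fin n))} {b d w : EuclideanSpace ℝ (Fin n) → ℝ}

theorem IsViscositySubsolution.piecewise_sup [∀ x, Decidable (x ∈ O)] (hO : IsOpen O)
    (hd : IsViscositySubsolution F μ U d) (hb : IsViscositySubsolution F μ O b)
    (hcont : Continuous (O.piecewise (d ⊔ b) d)) :
    IsViscositySubsolution F μ U (O.piecewise (d ⊔ b) d) := by
  have hle : d ≤ O.piecewise (d ⊔ b) d := le_piecewise (fun _ _ => le_sup_left) fun _ _ => le_rfl
  refine isViscositySubsolution_iff.2
    ⟨hcont.continuousOn.upperSemicontinuousOn, fun x hx p hp => ?_⟩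
  by_cases hxd : d x = O.piecewise (d ⊔ b) d x
  · exact (isViscositySubsolution_iff.1 hd).2 x hx p
      (hp.of_eventuallyLE (Eventually.of_forall hle) hxd)
  have hxO : x ∈ O := by
    by_contra hxO
    exact hxd (piecewise_eq_of_notMem O _ _ hxO).symm
  have hbx : b x = O.piecewise (d ⊔ b) d x := by
    rw [piecewise_eq_of_mem O _ _ hxO] at hxd ⊢
    exact (sup_eq_right.2 (not_le.1 fun h => hxd (sup_eq_left.2 h).symm).le).symm
  refine (isViscositySubsolution_iff.1 hb).2 x hxO p (hp.of_eventuallyLE ?_ hbx)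
  filter_upwards [hO.mem_nhds hxO] with y hy
  exact le_sup_right.trans_eq (piecewise_eq_of_mem O (d ⊔ b) d hy).symm

theorem isViscositySubsolution_of_isLUB {S : Set (EuclideanSpace ℝ (Fin n) → ℝ)}
    (hF : Continuous (Function.uncurry F)) (hU : IsOpen U) (hS : ∀ v ∈ S, Continuous v)
    (hsub : ∀ v ∈ S, IsViscositySubsolution F μ U v) (hd : Continuous d)
    (hsup : ∀ y, IsLUB ((fun v => v y) '' S) (d y)) : IsViscositySubsolution F μ U d :=
  isViscositySubsolution_iff.2 ⟨hd.continuousOn.upperSemicontinuousOn, fun _ hx _ hp =>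
    IsViscositySubsolution.le_of_mem_closure_biUnion hsub hF hU hx
      (hp.mem_closure_of_isLUB hS hsup)⟩

theorem exists_bump_of_isLocalMin {φ : EuclideanSpace ℝ (Fin n) → ℝ}
    {x : EuclideanSpace ℝ (Fin n)} (hF : Continuous (Function.uncurry F)) (hU : U ∈ 𝓝 x)
    (hφ : ContDiffAt ℝ 1 φ x) (hmin : IsLocalMin (fun y => d y - φ y) x)
    (hlt : F (gradient φ x) x < μ) :
    ∃ r > 0, ∃ b, Metric.closedBall x r ⊆ U ∧ ContinuousOn b (Metric.closedBall x r) ∧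
      IsViscositySubsolution F μ (Metric.ball x r) b ∧ (∀ y ∈ Metric.sphere x r, b y ≤ d y) ∧
      d x < b x := by
  have hnear : ∀ᶠ y in 𝓝 x, F (gradient φ y - (2 : ℝ) • (y - x)) y < μ := by
    have hgrad := continuousAt_gradient hφ
    have hcont : ContinuousAt (fun y => (gradient φ y - (2 : ℝ) • (y - x), y)) x := by fun_prop
    exact (hF.continuousAt.comp hcont).eventually_lt_const (by simpa using hlt)
  obtain ⟨r, hr, hball⟩ := Metric.nhds_basis_closedBall.mem_iff.1
    (((hφ.eventually (by simp)).and hmin).and (hnear.and hU))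
  have hdiff : ∀ y ∈ Metric.closedBall x r,
      ContDiffAt ℝ 1 (fun y => φ y - ‖y - x‖ ^ 2 + (d x - φ x + r ^ 2)) y := fun y hy =>
    ((hball hy).1.1.sub (contDiffAt_norm_sub_sq x y)).add contDiffAt_const
  refine ⟨r, hr, _, fun y hy => (hball hy).2.2,
    fun y hy => (hdiff y hy).continuousAt.continuousWithinAt,
    isViscositySubsolution_of_contDiffAt
      (fun y hy => hdiff y (Metric.ball_subset_closedBall hy)) fun y hy => ?_, fun y hy => ?_, ?_⟩
  · obtain ⟨⟨hφy, -⟩, hFy, -⟩ := hball (Metric.ball_subset_closedBall hy)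
    have hgrad := hasGradientAt_add (hasGradientAt_sub (hasGradientAt_gradient hφy)
      (hasGradientAt_norm_sub_sq x y)) (hasGradientAt_const y (d x - φ x + r ^ 2))
    rw [hgrad.gradient, add_zero]
    exact hFy.le
  · have hdφ := (hball (Metric.sphere_subset_closedBall hy)).1.2
    rw [mem_sphere_iff_norm.1 hy]
    linarith
  · rw [sub_self, norm_zero]
    linarith [pow_pos hr 2]

theorem isViscositySupersolution_of_maximal (hF : Continuous (Function.uncurry F)) (hU : IsOpen U)
    (hd : Continuous d) (hdU : IsViscositySubsolution F μ U d)
    (hmax : ∀ v, Continuous v → IsViscositySubsolution F μ U v → EqOn v d Uᶜ → v ≤ d) :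
    IsViscositySupersolution F μ U d := by
  refine ⟨hd.continuousOn.lowerSemicontinuousOn, fun x hx φ hφ hmin => ?_⟩
  by_contra! hlt
  obtain ⟨r, hr, b, hrU, hb, hbsub, hbd, hdb⟩ :=
    exists_bump_of_isLocalMin hF (hU.mem_nhds hx) hφ hmin hlt
  classical
  have hcont := continuous_piecewise_sup hd (hb.mono Metric.closure_ball_subset_closedBall)
    (frontier_ball x hr.ne' ▸ hbd)
  have hle := hmax _ hcont (hdU.piecewise_sup Metric.isOpen_ball hbsub hcont)
    (fun y hy => piecewise_eq_of_notMem _ _ _ fun hyr =>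
      hy (hrU (Metric.ball_subset_closedBall hyr))) x
  rw [piecewise_eq_of_mem _ _ _ (Metric.mem_ball_self hr)] at hle
  exact (hdb.trans_le (le_sup_right.trans hle)).false

theorem exists_isViscositySolution_ge {L : ℝ} {x₀ : EuclideanSpace ℝ (Fin n)}
    (hF : Continuous (Function.uncurry F)) (hL : ∀ q y, F q y ≤ μ → ‖q‖ ≤ L) (hw : Continuous w)
    (hwsub : IsViscositySubsolution F μ {x₀}ᶜ w) :
    ∃ d, Continuous d ∧ IsViscositySolution F μ {x₀}ᶜ d ∧ w ≤ d ∧ d x₀ = w x₀ := by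
  set S := {v | Continuous v ∧ IsViscositySubsolution F μ {x₀}ᶜ v ∧ v x₀ = w x₀}
  have hwS : w ∈ S := ⟨hw, hwsub, rfl⟩
  have hS_lip : ∀ v ∈ S, LipschitzWith (3 * L.toNNReal) v := fun v hv =>
    lipschitzWith_of_isSupergradientAt_norm_le hv.1 x₀ fun x hx p hp =>
      (hv.2.1.norm_le_of_isSupergradientAt hL hx hp).trans (Real.le_coe_toNNReal L)
  obtain ⟨d, hd⟩ : ∃ d : EuclideanSpace ℝ (Fin n) → ℝ,
      ∀ y, IsLUB ((fun v => v y) '' S) (d y) := by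
    refine ⟨_, fun y => isLUB_csSup ⟨w y, w, hwS, rfl⟩
      ⟨w x₀ + (3 * L.toNNReal : NNReal) * dist y x₀, ?_⟩⟩
    rintro _ ⟨v, hv, rfl⟩
    exact hv.2.2 ▸ (hS_lip v hv).le_add_mul y x₀
  have hle : ∀ v ∈ S, v ≤ d := fun v hv y => (hd y).1 ⟨v, hv, rfl⟩
  have hd_lip : LipschitzWith (3 * L.toNNReal) d := by
    refine LipschitzWith.of_le_add_mul _ fun y z => (hd y).2 ?_
    rintro _ ⟨v, hv, rfl⟩
    exact ((hS_lip v hv).le_add_mul y z).trans (add_le_add_left (hle v hv z) _)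
  have hdx₀ : d x₀ = w x₀ := le_antisymm
    ((hd x₀).2 (by rintro _ ⟨v, hv, rfl⟩; exact hv.2.2.le)) (hle w hwS x₀)
  have hd_sub : IsViscositySubsolution F μ {x₀}ᶜ d := isViscositySubsolution_of_isLUB hF
    isOpen_compl_singleton (fun v hv => hv.1) (fun v hv => hv.2.1) hd_lip.continuous hd
  exact ⟨d, hd_lip.continuous, ⟨hd_sub, isViscositySupersolution_of_maximal hF
    isOpen_compl_singleton hd_lip.continuous hd_sub fun v hv hvsub heq =>
      hle v ⟨hv, hvsub, (heq (by simp)).trans hdx₀⟩⟩, hle w hwS, hdx₀⟩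

end Perron

section LinearGrowth

open Asymptotics

variable {E : Type*} [NormedAddCommGroup E] {f g : E → ℝ}

/-- `f` grows at least linearly at infinity. This is the real-valued form of the condition
`liminf f(y) / |y| > 0`. -/
def HasLinearGrowth (f : E → ℝ) : Prop :=
  ∃ a > 0, ∀ᶠ y in cocompact E, a * ‖y‖ ≤ f y

namespace HasLinearGrowth

theorem mono (hf : HasLinearGrowth f) (hfg : f ≤ g) : HasLinearGrowth g := by
  obtain ⟨a, ha, hfa⟩ := hf
  exact ⟨a, ha, hfa.mono fun y hy => hy.trans (hfg y)⟩

theorem const_mul {c : ℝ} (hc : 0 < c) (hf : HasLinearGrowth f) :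
    HasLinearGrowth (fun y => c * f y) := by
  obtain ⟨a, ha, hfa⟩ := hf
  refine ⟨c * a, mul_pos hc ha, hfa.mono fun y hy => ?_⟩
  rw [mul_assoc]
  exact mul_le_mul_of_nonneg_left hy hc.le

theorem add_isLittleO (hf : HasLinearGrowth f) (hg : g =o[cocompact E] norm) :
    HasLinearGrowth (fun y => f y + g y) := by
  obtain ⟨a, ha, hfa⟩ := hf
  refine ⟨a / 2, half_pos ha, ?_⟩
  filter_upwards [hfa, hg.bound (half_pos ha)] with y hfy hgy
  rw [norm_norm] at hgy
  linarith [neg_le_of_abs_le hgy]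

theorem eventually_add_const_mul (hf : HasLinearGrowth f) (hg : g =O[cocompact E] norm) :
    ∀ᶠ τ in 𝓝 (0 : ℝ), HasLinearGrowth (fun y => f y + τ * g y) := by
  obtain ⟨a, ha, hfa⟩ := hf
  obtain ⟨C, hgC⟩ := hg.bound
  have hsmall : ∀ᶠ τ in 𝓝 (0 : ℝ), |τ| * C < a / 2 :=
    (by fun_prop : Continuous fun τ : ℝ => |τ| * C).continuousAt.eventually_lt_const
      (by simpa using half_pos ha)
  filter_upwards [hsmall] with τ hτ
  refine ⟨a / 2, half_pos ha, ?_⟩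
  filter_upwards [hfa, hgC] with y hfy hgy
  rw [norm_norm] at hgy
  have hτg := mul_le_mul_of_nonneg_left hgy (abs_nonneg τ)
  rw [Real.norm_eq_abs, ← abs_mul, ← mul_assoc] at hτg
  have hτy := mul_le_mul_of_nonneg_right hτ.le (norm_nonneg y)
  linarith [neg_abs_le (τ * g y)]

variable [ProperSpace E]

theorem tendsto_atTop (hf : HasLinearGrowth f) : Tendsto f (cocompact E) atTop := by
  obtain ⟨a, ha, hfa⟩ := hf
  exact tendsto_atTop_mono' _ hfa ((tendsto_norm_cocompact_atTop).const_mul_atTop ha)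

end HasLinearGrowth

theorem isLittleO_const_norm_cocompact [ProperSpace E] (c : ℝ) :
    (fun _ => c) =o[cocompact E] (norm : E → ℝ) :=
  isLittleO_const_left.2 (Or.inr (by simpa [Function.comp_def] using tendsto_norm_cocompact_atTop))

theorem eventually_norm_pos_cocompact [ProperSpace E] : ∀ᶠ y in cocompact E, 0 < ‖y‖ :=
  (tendsto_norm_cocompact_atTop).eventually_gt_atTop 0

theorem hasLinearGrowth_iff_liminf_pos [ProperSpace E] :
    HasLinearGrowth f ↔ 0 < liminf (fun y => ((‖y‖⁻¹ * f y : ℝ) : EReal)) (cocompact E) := by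
  constructor
  · rintro ⟨a, ha, hfa⟩
    refine (EReal.coe_pos.2 ha).trans_le (le_liminf_of_le (h := ?_))
    filter_upwards [hfa, eventually_norm_pos_cocompact] with y hy hy₀
    rwa [EReal.coe_le_coe_iff, inv_mul_eq_div, le_div_iff₀ hy₀]
  · intro h
    obtain ⟨a, ha₀, ha⟩ := EReal.lt_iff_exists_real_btwn.1 h
    refine ⟨a, EReal.coe_pos.1 ha₀, ?_⟩
    filter_upwards [eventually_lt_of_lt_liminf ha, eventually_norm_pos_cocompact] with y hy hy₀
    rw [EReal.coe_lt_coe_iff, inv_mul_eq_div, lt_div_iff₀ hy₀] at hy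
    exact hy.le

theorem isLittleO_norm_iff_tendsto [ProperSpace E] :
    f =o[cocompact E] norm ↔ Tendsto (fun y => ‖y‖⁻¹ * f y) (cocompact E) (𝓝 0) := by
  simp_rw [inv_mul_eq_div]
  exact isLittleO_iff_tendsto'
    (eventually_norm_pos_cocompact.mono fun y hy h => absurd h hy.ne')

theorem hasLinearGrowth_dist [ProperSpace E] (a : E) : HasLinearGrowth (fun y => dist y a) := by
  have hnorm : HasLinearGrowth (norm : E → ℝ) :=
    ⟨1, one_pos, Eventually.of_forall fun y => (one_mul _).le⟩
  exact (hnorm.add_isLittleO (isLittleO_const_norm_cocompact (-‖a‖))).mono fun y =>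
    (norm_sub_norm_le y a).trans_eq (dist_eq_norm y a).symm

theorem isBigO_norm_of_lipschitzWith [ProperSpace E] {K : NNReal} (hf : LipschitzWith K f) :
    f =O[cocompact E] norm := by
  have hlip : (fun y => f y - f 0) =O[cocompact E] norm :=
    IsBigO.of_bound K (Eventually.of_forall fun y => by
      simpa [dist_eq_norm] using hf.dist_le_mul y 0)
  simpa using hlip.add (isLittleO_const_norm_cocompact (f 0)).isBigO

end LinearGrowth

section MetricProblem

open Asymptotics

variable {n : ℕ} {F : EuclideanSpace ℝ (Fin n) → EuclideanSpace ℝ (Fin n) → ℝ} {μ μ' L : ℝ}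
  {δ : NNReal} {x₀ : EuclideanSpace ℝ (Fin n)} {u v w : EuclideanSpace ℝ (Fin n) → ℝ}

/-- `w` is a sublinear function, normalised by `w x₀ = 0`, which stays a subsolution of
`F(Dw, y) ≤ μ` in the whole space after adding any `δ`-Lipschitz function. Strict subsolutions have
this property, and it allows them to be tilted by multiples of `|y - x₀|`. -/
structure IsStableSubcorrector
    (F : EuclideanSpace ℝ (Fin n) → EuclideanSpace ℝ (Fin n) → ℝ) (μ : ℝ) (δ : NNReal)
    (x₀ : EuclideanSpace ℝ (Fin n)) (w : EuclideanSpace ℝ (Fin n) → ℝ) : Prop where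
  continuous : Continuous w
  sublinear : w =o[cocompact (EuclideanSpace ℝ (Fin n))] norm
  eq_zero : w x₀ = 0
  isViscositySubsolution_add : ∀ ψ, LipschitzWith δ ψ →
    IsViscositySubsolution F μ univ (fun y => w y + ψ y)

theorem lipschitzWith_const_mul {X : Type*} [PseudoEMetricSpace X] {K : NNReal} {f : X → ℝ}
    (δ : NNReal) (hf : LipschitzWith K f) : LipschitzWith (δ * K) (fun y => δ * f y) := by
  simpa [Function.comp_def] using (lipschitzWith_smul (δ : ℝ)).comp hf

theorem IsStableSubcorrector.hasLinearGrowth_add_const_mul_dist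
    (hw : IsStableSubcorrector F μ δ x₀ w) (hδ : 0 < δ) :
    HasLinearGrowth (fun y => w y + δ * dist y x₀) := by
  simpa only [add_comm] using
    ((hasLinearGrowth_dist x₀).const_mul (NNReal.coe_pos.2 hδ)).add_isLittleO hw.sublinear

theorem IsStableSubcorrector.convexCombination_le {θ : ℝ} (hF : Continuous (Function.uncurry F))
    (hconvex : ∀ y, ConvexOn ℝ univ fun q => F q y) (hL : ∀ q y, F q y ≤ μ → ‖q‖ ≤ L)
    (hw : IsStableSubcorrector F μ' δ x₀ w) (hμ : μ' < μ)
    (hu : IsViscositySubsolution F μ {x₀}ᶜ u) (hv : IsViscositySupersolution F μ {x₀}ᶜ v)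
    (huc : Continuous u) (hvc : Continuous v) (hux : u x₀ = 0) (hvx : v x₀ = 0)
    (hθ : θ ∈ Ioo 0 1) (hgrowth : HasLinearGrowth (fun y => v y - θ * u y))
    (y : EuclideanSpace ℝ (Fin n)) : θ * u y + (1 - θ) * (w y + δ * dist y x₀) ≤ v y := by
  -- Truncating the tilt at height `dist y x₀` makes it sublinear and does not change it at `y`.
  set ψ : EuclideanSpace ℝ (Fin n) → ℝ := fun z => δ * min (dist z x₀) (dist y x₀)
  have hψ : LipschitzWith δ ψ := by
    simpa using lipschitzWith_const_mul δ ((LipschitzWith.dist_left x₀).min_const (dist y x₀))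
  have hψo : ψ =o[cocompact (EuclideanSpace ℝ (Fin n))] norm := by
    refine IsBigO.trans_isLittleO (IsBigO.of_bound' (Eventually.of_forall fun z => ?_))
      (isLittleO_const_norm_cocompact (δ * dist y x₀))
    rw [Real.norm_of_nonneg (by positivity), Real.norm_of_nonneg (by positivity)]
    exact mul_le_mul_of_nonneg_left (min_le_right _ _) δ.2
  have hlevel : θ * μ + (1 - θ) * μ' < μ := by
    linarith [mul_lt_mul_of_pos_left hμ (sub_pos.2 hθ.2)]
  have hsub := IsViscositySubsolution.convexCombination hF hconvex hL isOpen_compl_singleton hu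
    ((hw.isViscositySubsolution_add ψ hψ).mono (subset_univ _) le_rfl) huc.continuousOn
    (hw.continuous.add hψ.continuous).continuousOn hθ
  have hlim : Tendsto (fun z => v z - (θ * u z + (1 - θ) * (w z + ψ z)))
      (cocompact (EuclideanSpace ℝ (Fin n))) atTop := by
    refine (hgrowth.add_isLittleO
      ((hw.sublinear.add hψo).const_mul_left (-(1 - θ)))).tendsto_atTop.congr fun z => ?_
    ring
  have hmin := hv.sub_le_sub_of_tendsto_atTop hF (fun q z hq => hL q z (hq.trans hlevel.le)) hsub
    hlevel hvc ((huc.const_mul θ).add ((hw.continuous.add hψ.continuous).const_mul (1 - θ))) hlim y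
  simp only [ψ, hux, hvx, hw.eq_zero, dist_self, min_eq_left dist_nonneg, min_self, mul_zero,
    add_zero, sub_zero] at hmin
  exact sub_nonneg.1 hmin

-- The contractions `θ u + (1 - θ) w` are compared with `v` for `θ` increasing to `1`: the
-- inequality at `θ` forces `v - θ u` to grow linearly, hence `v - θ' u` for nearby `θ'`, which
-- allows comparison at `θ'`.
theorem IsStableSubcorrector.le_of_hasLinearGrowth (hF : Continuous (Function.uncurry F))
    (hconvex : ∀ y, ConvexOn ℝ univ fun q => F q y) (hL : ∀ q y, F q y ≤ μ → ‖q‖ ≤ L)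
    (hw : IsStableSubcorrector F μ' δ x₀ w) (hδ : 0 < δ) (hμ : μ' < μ)
    (hu : IsViscositySubsolution F μ {x₀}ᶜ u) (hv : IsViscositySupersolution F μ {x₀}ᶜ v)
    (huc : Continuous u) (hvc : Continuous v) (hux : u x₀ = 0) (hvx : v x₀ = 0)
    (hgrowth : HasLinearGrowth v) : u ≤ v := by
  have hu_isBigO := isBigO_norm_of_lipschitzWith <|
    lipschitzWith_of_isSupergradientAt_norm_le huc x₀ fun x hx p hp =>
      (hu.norm_le_of_isSupergradientAt hL hx hp).trans (Real.le_coe_toNNReal L)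
  set A := {θ : ℝ | ∀ y, θ * u y + (1 - θ) * (w y + δ * dist y x₀) ≤ v y}
  have hA_growth : ∀ θ < 1, θ ∈ A → HasLinearGrowth (fun y => v y - θ * u y) := fun θ hθ hθA =>
    ((hw.hasLinearGrowth_add_const_mul_dist hδ).const_mul (sub_pos.2 hθ)).mono fun y =>
      le_sub_iff_add_le'.2 (hθA y)
  have hgrowth_open (θ : ℝ) (hθ : HasLinearGrowth (fun y => v y - θ * u y)) :
      ∀ᶠ θ' in 𝓝[>] θ, HasLinearGrowth (fun y => v y - θ' * u y) := by
    have hshift : Tendsto (fun θ' => θ - θ') (𝓝[>] θ) (𝓝 0) :=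
      ((continuous_const.sub continuous_id).tendsto' θ 0 (sub_self θ)).mono_left nhdsWithin_le_nhds
    filter_upwards [hshift.eventually (hθ.eventually_add_const_mul hu_isBigO)] with θ' hθ'
    exact hθ'.mono fun y => (by ring : v y - θ * u y + (θ - θ') * u y = v y - θ' * u y).le
  have hA_of_growth : ∀ θ ∈ Ioo (0 : ℝ) 1, HasLinearGrowth (fun y => v y - θ * u y) → θ ∈ A :=
    fun θ hθ h => hw.convexCombination_le hF hconvex hL hμ hu hv huc hvc hux hvx hθ h
  obtain ⟨θ₀, hθ₀_growth, hθ₀⟩ := ((hgrowth_open 0 (by simpa using hgrowth)).and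
    (Ioo_mem_nhdsGT one_pos)).exists
  have hA_closed : IsClosed A := by
    simp only [A, ofPred_forall]
    exact isClosed_iInter fun y => isClosed_le (by fun_prop) continuous_const
  have hIcc : Icc θ₀ 1 ⊆ A := by
    refine (hA_closed.inter isClosed_Icc).Icc_subset_of_forall_mem_nhdsWithin
      (hA_of_growth θ₀ hθ₀ hθ₀_growth) fun θ hθ => ?_
    filter_upwards [hgrowth_open θ (hA_growth θ hθ.2.2 hθ.1), Ioo_mem_nhdsGT hθ.2.2] with θ' h hθ'
    exact hA_of_growth θ' ⟨hθ₀.1.trans_le (hθ.2.1.trans hθ'.1.le), hθ'.2⟩ h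
  intro y
  simpa using hIcc (right_mem_Icc.2 hθ₀.2.le) y

theorem IsStableSubcorrector.existsUnique_isViscositySolution
    (hF : Continuous (Function.uncurry F)) (hconvex : ∀ y, ConvexOn ℝ univ fun q => F q y)
    (hL : ∀ q y, F q y ≤ μ → ‖q‖ ≤ L) (hw : IsStableSubcorrector F μ' δ x₀ w) (hδ : 0 < δ)
    (hμ : μ' < μ) :
    ∃! d : EuclideanSpace ℝ (Fin n) → ℝ,
      Continuous d ∧ IsViscositySolution F μ {x₀}ᶜ d ∧ HasLinearGrowth d ∧ d x₀ = 0 := by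
  have hdist : LipschitzWith δ (fun y => δ * dist y x₀) := by
    simpa using lipschitzWith_const_mul δ (LipschitzWith.dist_left x₀)
  obtain ⟨d, hd, hdsol, hwd, hdx⟩ := exists_isViscositySolution_ge hF hL
    (hw.continuous.add hdist.continuous)
    ((hw.isViscositySubsolution_add _ hdist).mono (subset_univ {x₀}ᶜ) hμ.le)
  have hd_growth : HasLinearGrowth d := (hw.hasLinearGrowth_add_const_mul_dist hδ).mono hwd
  have hdx₀ : d x₀ = 0 := by simpa [hw.eq_zero] using hdx
  refine ⟨d, ⟨hd, hdsol, hd_growth, hdx₀⟩, ?_⟩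
  rintro e ⟨he, hesol, he_growth, hex₀⟩
  exact le_antisymm
    (hw.le_of_hasLinearGrowth hF hconvex hL hδ hμ hesol.1 hdsol.2 he hd hex₀ hdx₀ hd_growth)
    (hw.le_of_hasLinearGrowth hF hconvex hL hδ hμ hdsol.1 hesol.2 hd he hdx₀ hex₀ he_growth)

end MetricProblem

section EffectiveHamiltonian

variable {n : ℕ} {F H : EuclideanSpace ℝ (Fin n) → EuclideanSpace ℝ (Fin n) → ℝ} {μ μ' : ℝ}

theorem exists_norm_le_of_tendsto_iInf_top {E Y : Type*} [NormedAddCommGroup E] {H : E → Y → ℝ}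
    (hcoercive : Tendsto (fun q => ⨅ y, (H q y : EReal)) (cocompact E) (𝓝 ⊤)) (p : E) (μ : ℝ) :
    ∃ L, ∀ q y, H (p + q) y ≤ μ → ‖q‖ ≤ L := by
  obtain ⟨K, hK, hμK⟩ := mem_cocompact.1
    (hcoercive.eventually (lt_mem_nhds (EReal.coe_lt_top μ)))
  obtain ⟨R, hR⟩ := hK.isBounded.exists_norm_le
  refine ⟨R + ‖p‖, fun q y hq => ?_⟩
  have hmem : p + q ∈ K := by
    by_contra hnot
    have hlt : (μ : EReal) < ⨅ y, (H (p + q) y : EReal) := hμK hnot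
    exact hq.not_gt (EReal.coe_lt_coe_iff.1 (hlt.trans_le (iInf_le _ y)))
  have htriangle : ‖q‖ ≤ ‖p + q‖ + ‖p‖ := by simpa using norm_sub_le (p + q) p
  linarith [hR _ hmem]

theorem exists_forall_add_le_of_convexOn {E Y : Type*} [NormedAddCommGroup E] [NormedSpace ℝ E]
    {F : E → Y → ℝ} {L C : ℝ} (hconvex : ∀ y, ConvexOn ℝ univ fun q => F q y)
    (hL : ∀ q y, F q y ≤ μ → ‖q‖ ≤ L) (hC : ∀ q, ‖q‖ ≤ L + 1 → ∀ y, F q y ≤ C) (hμ : μ < μ') :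
    ∃ δ : NNReal, 0 < δ ∧ ∀ q e y, F q y ≤ μ → ‖e‖ ≤ δ → F (q + e) y ≤ μ' := by
  obtain ⟨δ, hδ, hδ₁, hδC⟩ : ∃ δ : ℝ, 0 < δ ∧ δ < 1 ∧ δ * (C - μ) < μ' - μ := by
    have hsmall : ∀ᶠ δ in 𝓝[>] (0 : ℝ), δ * (C - μ) < μ' - μ :=
      ((by fun_prop : Continuous fun δ : ℝ => δ * (C - μ)).continuousAt.eventually_lt_const
        (by simpa using hμ)).filter_mono nhdsWithin_le_nhds
    obtain ⟨δ, hδC, hδ⟩ := (hsmall.and (Ioo_mem_nhdsGT one_pos)).exists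
    exact ⟨δ, hδ.1, hδ.2, hδC⟩
  refine ⟨⟨δ, hδ.le⟩, hδ, fun q e y hq he => ?_⟩
  have hball : ‖q + δ⁻¹ • e‖ ≤ L + 1 := by
    refine (norm_add_le _ _).trans (add_le_add (hL q y hq) ?_)
    rw [norm_smul, norm_inv, Real.norm_of_nonneg hδ.le]
    exact inv_mul_le_one_of_le₀ he hδ.le
  calc F (q + e) y = F ((1 - δ) • q + δ • (q + δ⁻¹ • e)) y := by
        rw [smul_add, smul_inv_smul₀ hδ.ne', ← add_assoc, ← add_smul, sub_add_cancel, one_smul]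
    _ ≤ (1 - δ) • F q y + δ • F (q + δ⁻¹ • e) y :=
        (hconvex y).2 (mem_univ _) (mem_univ _) (sub_nonneg.2 hδ₁.le) hδ.le (sub_add_cancel _ _)
    _ ≤ (1 - δ) * μ + δ * C :=
        add_le_add (mul_le_mul_of_nonneg_left hq (sub_nonneg.2 hδ₁.le))
          (mul_le_mul_of_nonneg_left (hC _ hball y) hδ.le)
    _ ≤ μ' := by linarith

theorem exists_sublinear_subsolution_of_effectiveHamiltonian_lt {C : ℝ}
    {p : EuclideanSpace ℝ (Fin n)} (hC : ∀ y, H p y ≤ C) (hμ : effectiveHamiltonian H p < μ) :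
    ∃ μ' < μ, ∃ w : EuclideanSpace ℝ (Fin n) → ℝ, Continuous w ∧
      IsViscositySubsolution (fun q y => H (p + q) y) μ' univ w ∧
      w =o[cocompact (EuclideanSpace ℝ (Fin n))] norm := by
  have hzero : IsViscositySubsolution (fun q y => H (p + q) y) C univ (fun _ => 0) :=
    isViscositySubsolution_of_contDiffAt (fun _ _ => contDiffAt_const) fun y _ => by
      simpa using hC y
  obtain ⟨μ', ⟨w, ⟨K, hK⟩, hw, hlim⟩, hlt⟩ := exists_lt_of_csInf_lt
    (by exact ⟨C, fun _ => 0, ⟨0, LipschitzWith.const 0⟩, hzero,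
      by simpa using tendsto_const_nhds⟩) hμ
  exact ⟨μ', hlt, w, hK.continuous, hw, isLittleO_norm_iff_tendsto.2 hlim⟩

theorem IsViscositySubsolution.exists_isStableSubcorrector {L C : ℝ}
    {w : EuclideanSpace ℝ (Fin n) → ℝ} (hF : Continuous (Function.uncurry F))
    (hconvex : ∀ y, ConvexOn ℝ univ fun q => F q y) (hL : ∀ q y, F q y ≤ μ → ‖q‖ ≤ L)
    (hC : ∀ q, ‖q‖ ≤ L + 1 → ∀ y, F q y ≤ C) (hμ : μ < μ')
    (hw : IsViscositySubsolution F μ univ w) (hwc : Continuous w)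
    (hwo : w =o[cocompact (EuclideanSpace ℝ (Fin n))] norm) (x₀ : EuclideanSpace ℝ (Fin n)) :
    ∃ δ > 0, IsStableSubcorrector F μ' δ x₀ (fun y => w y - w x₀) := by
  obtain ⟨δ, hδ, hδF⟩ := exists_forall_add_le_of_convexOn hconvex hL hC hμ
  refine ⟨δ, hδ, hwc.sub continuous_const, hwo.sub (isLittleO_const_norm_cocompact _),
    sub_self _, fun ψ hψ => ?_⟩
  have hψ' : LipschitzWith δ (fun y => ψ y - w x₀) := by
    simpa using hψ.sub (LipschitzWith.const (w x₀))
  simpa only [add_sub, sub_add_eq_add_sub] using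
    hw.add_lipschitzWith hF hL hδF isOpen_univ hwc.continuousOn hψ'

end EffectiveHamiltonian

theorem proposition3p3_general {n : ℕ}
    {H : EuclideanSpace ℝ (Fin n) → EuclideanSpace ℝ (Fin n) → ℝ}
    (hH : Continuous (Function.uncurry H)) (hconvex : ∀ y, ConvexOn ℝ univ (fun q => H q y))
    (hcoercive : Tendsto (fun q => ⨅ y, (H q y : EReal))
      (cocompact (EuclideanSpace ℝ (Fin n))) (𝓝 ⊤))
    (hbdd : ∀ R : ℝ, 0 < R → ∃ C, ∀ q ∈ Metric.ball 0 R, ∀ y, H q y ≤ C)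
    {p : EuclideanSpace ℝ (Fin n)} {μ : ℝ} (hμ : effectiveHamiltonian H p < μ)
    (x₀ : EuclideanSpace ℝ (Fin n)) :
    ∃! d : EuclideanSpace ℝ (Fin n) → ℝ,
      Continuous d ∧
      IsViscositySolution (fun q y => H (p + q) y) μ {x₀}ᶜ d ∧
      0 < liminf (fun y => ((‖y‖⁻¹ * d y : ℝ) : EReal))
        (cocompact (EuclideanSpace ℝ (Fin n))) ∧
      d x₀ = 0 := by
  have hF : Continuous (Function.uncurry fun q y => H (p + q) y) :=
    hH.comp ((continuous_const_add p).prodMap continuous_id)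
  have hFconvex (y) : ConvexOn ℝ univ fun q => H (p + q) y := (hconvex y).translate_right p
  obtain ⟨C₀, hC₀⟩ := hbdd (‖p‖ + 1) (by positivity)
  obtain ⟨μ₁, hμ₁, w, hwc, hw, hwo⟩ :=
    exists_sublinear_subsolution_of_effectiveHamiltonian_lt (hC₀ p (by simp)) hμ
  obtain ⟨μ₂, hμ₁₂, hμ₂⟩ := exists_between hμ₁
  obtain ⟨L, hL⟩ := exists_norm_le_of_tendsto_iInf_top hcoercive p μ
  have hL₁ (q y) (hq : H (p + q) y ≤ μ₁) : ‖q‖ ≤ L := hL q y (hq.trans hμ₁.le)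
  obtain ⟨C, hC⟩ := hbdd (‖p‖ + |L| + 2) (by positivity)
  have hFC (q) (hq : ‖q‖ ≤ L + 1) : ∀ y, H (p + q) y ≤ C :=
    hC (p + q) (by simpa using by linarith [norm_add_le p q, le_abs_self L])
  obtain ⟨δ, hδ, hwδ⟩ := hw.exists_isStableSubcorrector hF hFconvex hL₁ hFC hμ₁₂ hwc hwo x₀
  simp only [← hasLinearGrowth_iff_liminf_pos]
  exact hwδ.existsUnique_isViscositySolution hF hFconvex hL hδ hμ₂

theorem continuous_of_uniformContinuousOn_ball_prod_univ {E Y Z : Type*} [NormedAddCommGroup E]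
    [UniformSpace Y] [UniformSpace Z] {f : E × Y → Z}
    (hf : ∀ R : ℝ, 0 < R → UniformContinuousOn f (Metric.ball 0 R ×ˢ univ)) : Continuous f := by
  refine continuous_iff_continuousAt.2 fun z => ?_
  exact (hf (‖z.1‖ + 1) (by positivity)).continuousOn.continuousAt
    ((Metric.isOpen_ball.prod isOpen_univ).mem_nhds ⟨by simp, mem_univ _⟩)

theorem proposition3p3 (n : ℕ) (hn : 1 ≤ n)
    (H : EuclideanSpace ℝ (Fin n) → EuclideanSpace ℝ (Fin n) → ℝ)
    (hconvex : ∀ y, ConvexOn ℝ univ (fun q => H q y))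
    (hcoercive : Tendsto (fun q => ⨅ y, (H q y : EReal))
      (cocompact (EuclideanSpace ℝ (Fin n))) (𝓝 ⊤))
    (hregular : ∀ R : ℝ, 0 < R →
      UniformContinuousOn (fun z : EuclideanSpace ℝ (Fin n) × EuclideanSpace ℝ (Fin n) =>
        H z.1 z.2) (Metric.ball 0 R ×ˢ univ) ∧
      ∃ C : ℝ, ∀ q ∈ Metric.ball (0 : EuclideanSpace ℝ (Fin n)) R, ∀ y, |H q y| ≤ C)
    (p : EuclideanSpace ℝ (Fin n)) (μ : ℝ) (hμ : effectiveHamiltonian H p < μ)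
    (x₀ : EuclideanSpace ℝ (Fin n)) :
    ∃! d : EuclideanSpace ℝ (Fin n) → ℝ,
      Continuous d ∧
      IsViscositySolution (fun q y => H (p + q) y) μ {x₀}ᶜ d ∧
      0 < liminf (fun y => ((‖y‖⁻¹ * d y : ℝ) : EReal))
        (cocompact (EuclideanSpace ℝ (Fin n))) ∧
      d x₀ = 0 := by
  refine proposition3p3_general (continuous_of_uniformContinuousOn_ball_prod_univ fun R hR =>
    (hregular R hR).1) hconvex hcoercive (fun R hR => ?_) hμ x₀
  exact (hregular R hR).2.imp fun C hC q hq y => le_of_abs_le (hC q hq y)
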